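/- Let $n\ge 0$, and let formulas be built from propositional variables by $\bot,\land,\lor,\to$ and unary modalities $\Box_1,\dots,\Box_n$. A sequent $\Gamma\Rightarrow\Delta$ is a pair of finite multisets of formulas. \emph{Multi-modal $\mathbf{S5}$} is the sequent calculus with initial sequents $x\Rightarrow x$ ($x$ a variable) and the following rules, where $\Gamma,\Delta,\Gamma',\Delta',\Sigma,\Pi$ are arbitrary finite multisets of formulas and $A,B,C$ arbitrary formulas. Structural rules: - weakening: from $\Gamma\Rightarrow\Delta$ infer $\Gamma,\Sigma\Rightarrow\Delta,\Pi$; - contraction: from $\Gamma\Rightarrow\Delta$ infer $\Gamma^*\Rightarrow\Delta^*$, where $\Gamma^*$ is obtained from $\Gamma$ (and $\Delta^*$ from $\Delta$) by lowering multiplicities, without removing the last occurrence of any formula; - multicut, for $p,q\ge 1$: from $\Gamma\Rightarrow\Delta,C^p$ and $C^q,\Gamma'\Rightarrow\Delta'$ infer $\Gamma,\Gamma'\Rightarrow\Delta,\Delta'$, where $C^p$ denotes $p$ copies of $C$; $C$ is called the cut formula. Logical rules of $\mathbf{LK}$: - $\Gamma,\bot\Rightarrow\Delta$ (no premise); from $\Gamma\Rightarrow\Delta$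 infer $\Gamma\Rightarrow\bot,\Delta$; - from $\Gamma,A,B\Rightarrow\Delta$ infer $\Gamma,A\land B\Rightarrow\Delta$; from $\Gamma\Rightarrow A,\Delta$ and $\Gamma\Rightarrow B,\Delta$ infer $\Gamma\Rightarrow A\land B,\Delta$; - from $\Gamma,A\Rightarrow\Delta$ and $\Gamma,B\Rightarrow\Delta$ infer $\Gamma,A\lor B\Rightarrow\Delta$; from $\Gamma\Rightarrow A,B,\Delta$ infer $\Gamma\Rightarrow A\lor B,\Delta$; - from $\Gamma\Rightarrow A,\Delta$ and $\Gamma,B\Rightarrow\Delta$ infer $\Gamma,A\to B\Rightarrow\Delta$; from $\Gamma,A\Rightarrow B,\Delta$ infer $\Gamma\Rightarrow A\to B,\Delta$. Modal rules, for each $i\in\{1,\dots,n\}$: - $(T)_i$: from $\Gamma,A\Rightarrow\Delta$ infer $\Gamma,\Box_iA\Rightarrow\Delta$; - $(5)_i$: from $\Box_i\Gamma\Rightarrow A,\Box_i\Delta$ infer $\Box_i\Gamma\Rightarrow\Box_iA,\Box_i\Delta$, where $\Box_i\Gamma=\{\Box_iF : F\in\Gamma\}$ (as a multiset); that is, every context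 formula is prefixed by the same $\Box_i$. An instance of multicut is \emph{analytic} if its cut formula is a (not necessarily proper) subformula of some formula in its conclusion, and a proof is \emph{locally analytic} if all instances of multicut in it are analytic. \textbf{Corollary.} Multi-modal $\mathbf{S5}$ has the analytic cut property: every sequent provable in multi-modal $\mathbf{S5}$ has a locally analytic proof. -/

import Mathlib

namespace MultiModalS5

universe u

/-- Formulas over the variables `V`, built from `⊥, ∧, ∨, →` and the modalities `□ᵢ`, `i : Fin n`. -/
inductive Formula (V : Type u) (n : ℕ) : Type u
  | var (x : V) : Formula V n
  | bot : Formula V n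
  | and (A B : Formula V n) : Formula V n
  | or (A B : Formula V n) : Formula V n
  | imp (A B : Formula V n) : Formula V n
  | box (i : Fin n) (A : Formula V n) : Formula V n

/-- `IsSubformula A B`: the formula `A` is a (not necessarily proper) subformula of `B`. -/
inductive IsSubformula {V : Type u} {n : ℕ} (A : Formula V n) : Formula V n → Prop
  | refl : IsSubformula A A
  | and_left {B C : Formula V n} : IsSubformula A B → IsSubformula A (.and B C)
  | and_right {B C : Formula V n} : IsSubformula A C → IsSubformula A (.and B C)
  | or_left {B C : Formula V n} : IsSubformula A B → IsSubformula A (.or B C)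
  | or_right {B C : Formula V n} : IsSubformula A C → IsSubformula A (.or B C)
  | imp_left {B C : Formula V n} : IsSubformula A B → IsSubformula A (.imp B C)
  | imp_right {B C : Formula V n} : IsSubformula A C → IsSubformula A (.imp B C)
  | box {i : Fin n} {B : Formula V n} : IsSubformula A B → IsSubformula A (.box i B)

/-- The two sides (antecedent, succedent) of a sequent. -/
inductive Side : Type
  | left
  | right

/-- A formula together with the side of the sequent on which it stands. -/
abbrev LFormula (V : Type u) (n : ℕ) : Type u := Side × Formula V n

/-- An occurrence of `A` in the antecedent. -/
abbrev l {V : Type u} {n : ℕ} (A : Formula V n) : LFormula V n := (Side.left, A)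

/-- An occurrence of `A` in the succedent. -/
abbrev r {V : Type u} {n : ℕ} (A : Formula V n) : LFormula V n := (Side.right, A)

/-- The sequent `A₁, …, Aₖ ⇒ B₁, …, Bₘ` is the multiset `{l A₁, …, l Aₖ, r B₁, …, r Bₘ}`. -/
abbrev Sequent (V : Type u) (n : ℕ) : Type u := Multiset (LFormula V n)

/-- `Γ'` is a contraction of `Γ`: the same formulas occur in both, and each occurs at least as often
in `Γ` as in `Γ'`. -/
def IsContraction {V : Type u} {n : ℕ} (Γ' Γ : Sequent V n) : Prop :=
  Γ' ≤ Γ ∧ ∀ A, A ∈ Γ ↔ A ∈ Γ'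

/-- Every labelled formula of `Γ` is of the form `l (□ᵢ F)` or `r (□ᵢ F)`, for the given `i`. -/
def AllBoxed {V : Type u} {n : ℕ} (i : Fin n) (Γ : Sequent V n) : Prop :=
  ∀ A ∈ Γ, ∃ F : Formula V n, A = l (.box i F) ∨ A = r (.box i F)

/-- Proof trees of multi-modal `S5` with modalities `□ᵢ`, `i : Fin n`: the calculus `LK` (initial
sequents, structural rules including multicut, logical rules) with the rules `(T)` and `(5)`
for each `□ᵢ`. -/
inductive Proof (V : Type u) (n : ℕ) : Sequent V n → Type u
  | id (x : V) : Proof V n {l (.var x), r (.var x)}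
  | weakening (Γ Δ : Sequent V n) : Proof V n Γ → Proof V n (Γ + Δ)
  | contraction (Γ Γ' : Sequent V n) (h : IsContraction Γ' Γ) : Proof V n Γ → Proof V n Γ'
  | mcut (Γ Δ : Sequent V n) (C : Formula V n) (p q : ℕ) (hp : p ≠ 0) (hq : q ≠ 0) :
      Proof V n (Γ + Multiset.replicate p (r C)) →
      Proof V n (Δ + Multiset.replicate q (l C)) → Proof V n (Γ + Δ)
  | botL (Γ : Sequent V n) : Proof V n (Γ + {l .bot})
  | botR (Γ : Sequent V n) : Proof V n Γ → Proof V n (Γ + {r .bot})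
  | andL (Γ : Sequent V n) (A B : Formula V n) :
      Proof V n (Γ + {l A, l B}) → Proof V n (Γ + {l (.and A B)})
  | andR (Γ : Sequent V n) (A B : Formula V n) :
      Proof V n (Γ + {r A}) → Proof V n (Γ + {r B}) → Proof V n (Γ + {r (.and A B)})
  | orL (Γ : Sequent V n) (A B : Formula V n) :
      Proof V n (Γ + {l A}) → Proof V n (Γ + {l B}) → Proof V n (Γ + {l (.or A B)})
  | orR (Γ : Sequent V n) (A B : Formula V n) :
      Proof V n (Γ + {r A, r B}) → Proof V n (Γ + {r (.or A B)})
  | impL (Γ : Sequent V n) (A B : Formula V n) :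
      Proof V n (Γ + {r A}) → Proof V n (Γ + {l B}) → Proof V n (Γ + {l (.imp A B)})
  | impR (Γ : Sequent V n) (A B : Formula V n) :
      Proof V n (Γ + {l A, r B}) → Proof V n (Γ + {r (.imp A B)})
  | boxL (i : Fin n) (Γ : Sequent V n) (A : Formula V n) :
      Proof V n (Γ + {l A}) → Proof V n (Γ + {l (.box i A)})
  | boxR (i : Fin n) (Γ : Sequent V n) (A : Formula V n) (h : AllBoxed i Γ) :
      Proof V n (Γ + {r A}) → Proof V n (Γ + {r (.box i A)})

/-- A proof is locally analytic if for every instance of multicut in it the cut formula is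
a subformula of some formula in the conclusion of that instance. -/
def Proof.LocallyAnalytic {V : Type u} {n : ℕ} : {Γ : Sequent V n} → Proof V n Γ → Prop
  | _, .id _ => True
  | _, .weakening _ _ π => π.LocallyAnalytic
  | _, .contraction _ _ _ π => π.LocallyAnalytic
  | _, .mcut Γ Δ C _ _ _ _ π₁ π₂ =>
      (∃ A ∈ Γ + Δ, IsSubformula C A.2) ∧ π₁.LocallyAnalytic ∧ π₂.LocallyAnalytic
  | _, .botL _ => True
  | _, .botR _ π => π.LocallyAnalytic
  | _, .andL _ _ _ π => π.LocallyAnalytic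
  | _, .andR _ _ _ π₁ π₂ => π₁.LocallyAnalytic ∧ π₂.LocallyAnalytic
  | _, .orL _ _ _ π₁ π₂ => π₁.LocallyAnalytic ∧ π₂.LocallyAnalytic
  | _, .orR _ _ _ π => π.LocallyAnalytic
  | _, .impL _ _ _ π₁ π₂ => π₁.LocallyAnalytic ∧ π₂.LocallyAnalytic
  | _, .impR _ _ _ π => π.LocallyAnalytic
  | _, .boxL _ _ _ π => π.LocallyAnalytic
  | _, .boxR _ _ _ _ π => π.LocallyAnalytic

/-- A sequent is provable if it is the endsequent of some proof. -/
def Provable {V : Type u} {n : ℕ} (Γ : Sequent V n) : Prop := Nonempty (Proof V n Γ)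

/-- The analytic cut property of multi-modal `S5`: every provable sequent has a locally analytic
proof. -/
def HasAnalyticCutProperty (V : Type u) (n : ℕ) : Prop :=
  ∀ Γ : Sequent V n, Provable Γ → ∃ π : Proof V n Γ, π.LocallyAnalytic

end MultiModalS5

namespace MultiModalS5

universe u v

variable {V : Type u} {n : ℕ}

/-! The argument is semantic. The full calculus, arbitrary cuts included, is sound for Kripke models
whose relations are equivalences (`Proof.sound`), and the locally analytic fragment is complete for
them. For completeness, a sequent without locally analytic proof extends by analytic cuts to one
that decides all its subformulas (`exists_isSaturated`). Such sequents are the worlds of a canonical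
model in which each world refutes itself (`World.truth`). The existence lemma
`World.exists_rel_of_box_mem` is where rule (5) and the restriction to subformulas meet. -/

/-- `Γ` has a locally analytic proof. -/
def AnalyticallyProvable (Γ : Sequent V n) : Prop := ∃ π : Proof V n Γ, π.LocallyAnalytic

/-! ### Admissible rules for locally analytic provability -/

theorem AnalyticallyProvable.mono {Γ Δ : Sequent V n} (h : AnalyticallyProvable Γ)
    (hs : Γ ⊆ Δ) : AnalyticallyProvable Δ := by
  obtain ⟨π, hπ⟩ := h
  -- Every formula of `Γ` survives in `Δ`, so passing from `Γ + Δ` to `Δ` only lowers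
  -- multiplicities.
  have hc : IsContraction Δ (Γ + Δ) := ⟨Multiset.le_add_left _ _, fun A => by
    rw [Multiset.mem_add]
    exact ⟨fun h => h.elim (fun h => hs h) id, Or.inr⟩⟩
  exact ⟨.contraction (Γ + Δ) Δ hc (.weakening Γ Δ π), hπ⟩

theorem IsSubformula.trans {A B C : Formula V n} (h : IsSubformula A B) (h' : IsSubformula B C) :
    IsSubformula A C := by
  induction h' with
  | refl => exact h
  | and_left _ ih => exact .and_left ih
  | and_right _ ih => exact .and_right ih
  | or_left _ ih => exact .or_left ih
  | or_right _ ih => exact .or_right ih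
  | imp_left _ ih => exact .imp_left ih
  | imp_right _ ih => exact .imp_right ih
  | box _ ih => exact .box ih

theorem setFinite_isSubformula (A : Formula V n) : {B | IsSubformula B A}.Finite := by
  induction A with
  | var x =>
    refine (Set.finite_singleton (Formula.var x)).subset ?_
    rintro B (_ | _); rfl
  | bot =>
    refine (Set.finite_singleton Formula.bot).subset ?_
    rintro B (_ | _); rfl
  | and A B hA hB =>
    refine ((hA.union hB).insert (A.and B)).subset ?_
    rintro C (_ | h | h)
    exacts [.inl rfl, .inr (.inl ‹_›), .inr (.inr ‹_›)]
  | or A B hA hB =>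
    refine ((hA.union hB).insert (A.or B)).subset ?_
    rintro C (_ | h | h)
    exacts [.inl rfl, .inr (.inl ‹_›), .inr (.inr ‹_›)]
  | imp A B hA hB =>
    refine ((hA.union hB).insert (A.imp B)).subset ?_
    rintro C (_ | h | h)
    exacts [.inl rfl, .inr (.inl ‹_›), .inr (.inr ‹_›)]
  | box i A hA =>
    refine (hA.insert (A.box i)).subset ?_
    rintro C (_ | h)
    exacts [.inl rfl, .inr ‹_›]

theorem AnalyticallyProvable.andL {Γ : Sequent V n} {A B : Formula V n}
    (h : AnalyticallyProvable (Γ + {l A, l B})) : AnalyticallyProvable (Γ + {l (.and A B)}) :=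
  h.elim fun π hπ => ⟨.andL Γ A B π, hπ⟩

theorem AnalyticallyProvable.andR {Γ : Sequent V n} {A B : Formula V n}
    (h : AnalyticallyProvable (Γ + {r A})) (h' : AnalyticallyProvable (Γ + {r B})) :
    AnalyticallyProvable (Γ + {r (.and A B)}) :=
  h.elim fun π hπ => h'.elim fun π' hπ' => ⟨.andR Γ A B π π', hπ, hπ'⟩

theorem AnalyticallyProvable.orL {Γ : Sequent V n} {A B : Formula V n}
    (h : AnalyticallyProvable (Γ + {l A})) (h' : AnalyticallyProvable (Γ + {l B})) :
    AnalyticallyProvable (Γ + {l (.or A B)}) :=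
  h.elim fun π hπ => h'.elim fun π' hπ' => ⟨.orL Γ A B π π', hπ, hπ'⟩

theorem AnalyticallyProvable.orR {Γ : Sequent V n} {A B : Formula V n}
    (h : AnalyticallyProvable (Γ + {r A, r B})) : AnalyticallyProvable (Γ + {r (.or A B)}) :=
  h.elim fun π hπ => ⟨.orR Γ A B π, hπ⟩

theorem AnalyticallyProvable.impL {Γ : Sequent V n} {A B : Formula V n}
    (h : AnalyticallyProvable (Γ + {r A})) (h' : AnalyticallyProvable (Γ + {l B})) :
    AnalyticallyProvable (Γ + {l (.imp A B)}) :=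
  h.elim fun π hπ => h'.elim fun π' hπ' => ⟨.impL Γ A B π π', hπ, hπ'⟩

theorem AnalyticallyProvable.impR {Γ : Sequent V n} {A B : Formula V n}
    (h : AnalyticallyProvable (Γ + {l A, r B})) : AnalyticallyProvable (Γ + {r (.imp A B)}) :=
  h.elim fun π hπ => ⟨.impR Γ A B π, hπ⟩

theorem AnalyticallyProvable.boxL {Γ : Sequent V n} {i : Fin n} {A : Formula V n}
    (h : AnalyticallyProvable (Γ + {l A})) : AnalyticallyProvable (Γ + {l (.box i A)}) :=
  h.elim fun π hπ => ⟨.boxL i Γ A π, hπ⟩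

theorem AnalyticallyProvable.boxR {Γ : Sequent V n} {i : Fin n} {A : Formula V n}
    (hΓ : AllBoxed i Γ) (h : AnalyticallyProvable (Γ + {r A})) :
    AnalyticallyProvable (Γ + {r (.box i A)}) :=
  h.elim fun π hπ => ⟨.boxR i Γ A hΓ π, hπ⟩

theorem AnalyticallyProvable.cut {Γ : Sequent V n} {C : Formula V n}
    (hC : ∃ A ∈ Γ, IsSubformula C A.2) (h : AnalyticallyProvable (Γ + {r C}))
    (h' : AnalyticallyProvable (Γ + {l C})) : AnalyticallyProvable Γ := by
  obtain ⟨π, hπ⟩ := h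
  obtain ⟨π', hπ'⟩ := h'
  obtain ⟨A, hA, hCA⟩ := hC
  have : AnalyticallyProvable (Γ + Γ) :=
    ⟨.mcut Γ Γ C 1 1 one_ne_zero one_ne_zero π π',
      ⟨A, Multiset.mem_add.2 (.inl hA), hCA⟩, hπ, hπ'⟩
  exact this.mono fun a ha => (Multiset.mem_add.1 ha).elim id id

theorem analyticallyProvable_identity (A : Formula V n) :
    AnalyticallyProvable ({l A, r A} : Sequent V n) := by
  induction A with
  | var x => exact ⟨.id x, trivial⟩
  | bot => exact AnalyticallyProvable.mono ⟨.botL 0, trivial⟩ (by intro a; simp +contextual)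
  | and A B hA hB =>
    refine (AnalyticallyProvable.andL (Γ := {r (A.and B)}) (A := A) (B := B) ?_).mono
      (by intro a; simp; tauto)
    refine (AnalyticallyProvable.andR (Γ := {l A, l B}) (A := A) (B := B) ?_ ?_).mono
      (by intro a; simp; tauto)
    · exact hA.mono (by intro a; simp; tauto)
    · exact hB.mono (by intro a; simp; tauto)
  | or A B hA hB =>
    refine (AnalyticallyProvable.orR (Γ := {l (A.or B)}) (A := A) (B := B) ?_).mono
      (by intro a; simp)
    refine (AnalyticallyProvable.orL (Γ := {r A, r B}) (A := A) (B := B) ?_ ?_).mono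
      (by intro a; simp; tauto)
    · exact hA.mono (by intro a; simp; tauto)
    · exact hB.mono (by intro a; simp; tauto)
  | imp A B hA hB =>
    refine (AnalyticallyProvable.impR (Γ := {l (A.imp B)}) (A := A) (B := B) ?_).mono
      (by intro a; simp)
    refine (AnalyticallyProvable.impL (Γ := {l A, r B}) (A := A) (B := B) ?_ ?_).mono
      (by intro a; simp; tauto)
    · exact hA.mono (by intro a; simp; tauto)
    · exact hB.mono (by intro a; simp; tauto)
  | box i A hA =>
    refine (AnalyticallyProvable.boxR (Γ := {l (A.box i)}) (i := i) (A := A) ?_ ?_).mono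
      (by intro a; simp)
    · intro a ha
      exact ⟨A, .inl (Multiset.mem_singleton.1 ha)⟩
    · exact (AnalyticallyProvable.boxL (Γ := {r A}) (i := i) (A := A)
        (hA.mono (by intro a; simp; tauto))).mono (by intro a; simp; tauto)

/-! ### Kripke semantics and soundness -/

/-- Truth of a formula at a world of a Kripke model with accessibility relations `R i` and
valuation `val`. -/
def Sat {W : Type v} (R : Fin n → W → W → Prop) (val : W → V → Prop) : Formula V n → W → Prop
  | .var x, w => val w x
  | .bot, _ => False
  | .and A B, w => Sat R val A w ∧ Sat R val B w
  | .or A B, w => Sat R val A w ∨ Sat R val B w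
  | .imp A B, w => Sat R val A w → Sat R val B w
  | .box i A, w => ∀ w', R i w w' → Sat R val A w'

/-- Truth of a labelled formula: formulas in the antecedent count negatively. -/
def LSat {W : Type v} (R : Fin n → W → W → Prop) (val : W → V → Prop) (w : W) :
    LFormula V n → Prop
  | (.left, A) => ¬ Sat R val A w
  | (.right, A) => Sat R val A w

theorem lSat_left {W : Type v} (R : Fin n → W → W → Prop) (val : W → V → Prop) (w : W)
    (A : Formula V n) : LSat R val w (l A) ↔ ¬ Sat R val A w := Iff.rfl

theorem lSat_right {W : Type v} (R : Fin n → W → W → Prop) (val : W → V → Prop) (w : W)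
    (A : Formula V n) : LSat R val w (r A) ↔ Sat R val A w := Iff.rfl

theorem Proof.sound {W : Type v} {R : Fin n → W → W → Prop} (hR : ∀ i, Equivalence (R i))
    (val : W → V → Prop) {Γ : Sequent V n} (π : Proof V n Γ) (w : W) :
    ∃ a ∈ Γ, LSat R val w a := by
  induction π generalizing w with
  | id x =>
    by_cases h : val w x
    · exact ⟨r (.var x), by simp, h⟩
    · exact ⟨l (.var x), by simp, h⟩
  | weakening Γ Δ _ ih =>
    obtain ⟨a, ha, h⟩ := ih w
    exact ⟨a, Multiset.mem_add.2 (.inl ha), h⟩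
  | contraction Γ Γ' hc _ ih =>
    obtain ⟨a, ha, h⟩ := ih w
    exact ⟨a, (hc.2 a).1 ha, h⟩
  | mcut Γ Δ C p q _ _ _ _ ih₁ ih₂ =>
    obtain ⟨a, ha, h⟩ := ih₁ w
    obtain ⟨b, hb, h'⟩ := ih₂ w
    rcases Multiset.mem_add.1 ha with ha | ha
    · exact ⟨a, Multiset.mem_add.2 (.inl ha), h⟩
    rcases Multiset.mem_add.1 hb with hb | hb
    · exact ⟨b, Multiset.mem_add.2 (.inr hb), h'⟩
    rw [Multiset.eq_of_mem_replicate ha] at h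
    rw [Multiset.eq_of_mem_replicate hb] at h'
    exact absurd h h'
  | botL Γ => exact ⟨l .bot, by simp, fun h => h⟩
  | botR Γ _ ih =>
    obtain ⟨a, ha, h⟩ := ih w
    exact ⟨a, Multiset.mem_add.2 (.inl ha), h⟩
  | boxR i Γ A hΓ _ ih =>
    by_contra hcon
    simp only [Multiset.mem_add, Multiset.mem_singleton, not_exists, not_and] at hcon
    refine hcon _ (.inr rfl) fun w' hw' => ?_
    obtain ⟨a, ha, h⟩ := ih w'
    rcases Multiset.mem_add.1 ha with ha | ha
    -- The truth value of a `□ᵢ`-formula is constant on each `R i`-class, so a boxed context formula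
    -- that holds at `w'` in the labelled sense also holds at `w`.
    · refine absurd ?_ (hcon a (.inl ha))
      obtain ⟨F, rfl | rfl⟩ := hΓ a ha
      · exact fun hF => h fun u hu => hF u ((hR i).trans hw' hu)
      · exact fun u hu => h u ((hR i).trans ((hR i).symm hw') hu)
    · rw [Multiset.mem_singleton.1 ha] at h
      exact h
  | boxL i Γ A _ ih =>
    obtain ⟨a, ha, h⟩ := ih w
    rcases Multiset.mem_add.1 ha with ha | ha
    · exact ⟨a, Multiset.mem_add.2 (.inl ha), h⟩
    · rw [Multiset.mem_singleton.1 ha] at h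
      exact ⟨l (.box i A), by simp, fun hA => h (hA w ((hR i).refl w))⟩
  | andL Γ A B _ ih | orR Γ A B _ ih | impR Γ A B _ ih =>
    have ih := ih w
    simp only [Multiset.mem_add, Multiset.insert_eq_cons, Multiset.mem_cons,
      Multiset.mem_singleton, or_and_right, exists_or, exists_eq_left, lSat_left, lSat_right, Sat] at ih ⊢
    generalize (∃ a ∈ Γ, LSat R val w a) = P at ih ⊢
    tauto
  | andR Γ A B _ _ ih₁ ih₂ | orL Γ A B _ _ ih₁ ih₂ | impL Γ A B _ _ ih₁ ih₂ =>
    have ih₁ := ih₁ w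
    have ih₂ := ih₂ w
    simp only [Multiset.mem_add, Multiset.mem_singleton, or_and_right, exists_or,
      exists_eq_left, lSat_left, lSat_right, Sat] at ih₁ ih₂ ⊢
    generalize (∃ a ∈ Γ, LSat R val w a) = P at ih₁ ih₂ ⊢
    tauto

/-! ### Saturated sequents -/

/-- A sequent without locally analytic proof in which every subformula of each of its formulas
occurs on one of the two sides. -/
structure IsSaturated (w : Sequent V n) : Prop where
  not_provable : ¬ AnalyticallyProvable w
  decides : ∀ a ∈ w, ∀ B, IsSubformula B a.2 → l B ∈ w ∨ r B ∈ w

theorem exists_decides_of_not_analyticallyProvable {Γ : Sequent V n}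
    (hΓ : ¬ AnalyticallyProvable Γ) {S : Set (Formula V n)} (hS : S.Finite)
    (hsub : ∀ B ∈ S, ∃ a ∈ Γ, IsSubformula B a.2) :
    ∃ w : Sequent V n, ¬ AnalyticallyProvable w ∧ Γ ⊆ w ∧
      (∀ a ∈ w, ∃ b ∈ Γ, IsSubformula a.2 b.2) ∧ ∀ B ∈ S, l B ∈ w ∨ r B ∈ w := by
  induction S, hS using Set.Finite.induction_on with
  | empty => exact ⟨Γ, hΓ, fun _ h => h, fun a ha => ⟨a, ha, .refl⟩, by simp⟩
  | @insert C S _ _ ih =>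
    obtain ⟨w, hw, hΓw, hws, hdec⟩ := ih fun B hB => hsub B (.inr hB)
    obtain ⟨c, hc, hCc⟩ := hsub C (.inl rfl)
    -- If both ways of placing `C` gave provable sequents, a cut on `C` would prove `w`; it is
    -- analytic because `C` is a subformula of a formula of `Γ ⊆ w`.
    have key : ∃ a : LFormula V n, (a = l C ∨ a = r C) ∧ ¬ AnalyticallyProvable (w + {a}) := by
      by_contra! hcon
      exact hw (.cut ⟨c, hΓw hc, hCc⟩ (hcon _ (.inr rfl)) (hcon _ (.inl rfl)))
    obtain ⟨a, ha, hwa⟩ := key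
    refine ⟨w + {a}, hwa, fun b hb => Multiset.mem_add.2 (.inl (hΓw hb)), fun b hb => ?_, ?_⟩
    · rcases Multiset.mem_add.1 hb with hb | hb
      · exact hws b hb
      · rw [Multiset.mem_singleton.1 hb]
        rcases ha with rfl | rfl <;> exact ⟨c, hc, hCc⟩
    · rintro B (rfl | hB)
      · rcases ha with rfl | rfl <;> simp
      · exact (hdec B hB).imp (fun h => Multiset.mem_add.2 (.inl h))
          fun h => Multiset.mem_add.2 (.inl h)

theorem exists_isSaturated {Γ : Sequent V n} (hΓ : ¬ AnalyticallyProvable Γ) :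
    ∃ w : Sequent V n, IsSaturated w ∧ Γ ⊆ w ∧ ∀ a ∈ w, ∃ b ∈ Γ, IsSubformula a.2 b.2 := by
  have hfin : {B | ∃ a ∈ Γ, IsSubformula B a.2}.Finite := by
    have : {B : Formula V n | ∃ a ∈ Γ, IsSubformula B a.2} =
        ⋃ a ∈ {a | a ∈ Γ}, {B | IsSubformula B a.2} := by ext; simp
    rw [this]
    exact Γ.finite_toSet.biUnion fun a _ => setFinite_isSubformula a.2
  obtain ⟨w, hw, hΓw, hws, hdec⟩ :=
    exists_decides_of_not_analyticallyProvable hΓ hfin fun _ h => h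
  refine ⟨w, ⟨hw, fun a ha B hB => hdec B ?_⟩, hΓw, hws⟩
  obtain ⟨b, hb, hab⟩ := hws a ha
  exact ⟨b, hb, hB.trans hab⟩

theorem analyticallyProvable_of_mem {Γ : Sequent V n} {A : Formula V n} (hl : l A ∈ Γ)
    (hr : r A ∈ Γ) : AnalyticallyProvable Γ :=
  (analyticallyProvable_identity A).mono (by intro a; simp; grind)

theorem IsSaturated.not_mem_right {w : Sequent V n} (hw : IsSaturated w) {A : Formula V n}
    (hl : l A ∈ w) : r A ∉ w := fun hr =>
  hw.not_provable (analyticallyProvable_of_mem hl hr)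

/-- Used with `Γ` a principal formula of `w`: a rule then reads backwards with all of `w` as context
of its premises. -/
theorem IsSaturated.not_provable_add {w Γ : Sequent V n} (hw : IsSaturated w) (hΓ : Γ ⊆ w) :
    ¬ AnalyticallyProvable (w + Γ) := fun h =>
  hw.not_provable (h.mono fun _ ha => (Multiset.mem_add.1 ha).elim id fun ha => hΓ ha)

/-! ### Canonical model -/

/-- The worlds of the canonical model. -/
abbrev World (V : Type u) (n : ℕ) : Type u := {w : Sequent V n // IsSaturated w}

/-- Two worlds are `i`-accessible if they contain the same labelled `□ᵢ`-formulas. -/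
def World.Rel (i : Fin n) (w w' : World V n) : Prop :=
  ∀ (s : Side) (A : Formula V n), (s, A.box i) ∈ w.1 ↔ (s, A.box i) ∈ w'.1

theorem World.rel_equivalence (i : Fin n) : Equivalence (World.Rel (V := V) i) :=
  ⟨fun _ _ _ => Iff.rfl, fun h s A => (h s A).symm, fun h h' s A => (h s A).trans (h' s A)⟩

/-- The canonical valuation. -/
def World.val (w : World V n) (x : V) : Prop := l (.var x) ∈ w.1

theorem World.exists_rel_of_box_mem {i : Fin n} {A : Formula V n} (w : World V n)
    (h : r (A.box i) ∈ w.1) : ∃ w' : World V n, World.Rel i w w' ∧ r A ∈ w'.1 := by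
  classical
  set Γ : Sequent V n := w.1.filter fun a => ∃ F, a = l (.box i F) ∨ a = r (.box i F) with hΓdef
  have hΓ : AllBoxed i Γ := fun a ha => (Multiset.mem_filter.1 ha).2
  have hmem : ∀ s F, (s, Formula.box i F) ∈ w.1 → (s, Formula.box i F) ∈ Γ := fun s F hF =>
    Multiset.mem_filter.2 ⟨hF, F, by cases s <;> simp⟩
  -- Rule (5) read backwards: its context is the part of `w` boxed by `i`.
  have hΓA : ¬ AnalyticallyProvable (Γ + {r A}) := fun hp =>
    w.2.not_provable ((AnalyticallyProvable.boxR hΓ hp).mono fun a ha => by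
      rcases Multiset.mem_add.1 ha with ha | ha
      · exact (Multiset.mem_filter.1 ha).1
      · rwa [Multiset.mem_singleton.1 ha])
  obtain ⟨w', hw', hΓw', hsub⟩ := exists_isSaturated hΓA
  refine ⟨⟨w', hw'⟩, fun s F => ⟨fun hF => hΓw' (Multiset.mem_add.2 (.inl (hmem s F hF))),
    fun hF => ?_⟩, hΓw' (by simp)⟩
  obtain ⟨b, hb, hFb⟩ := hsub _ hF
  -- `w'` contains only subformulas of `Γ + {r A}`, hence of `w`, so `w` has decided `F.box i`. The
  -- wrong side is excluded because it would be inherited by `w'`. Thus `w'` has no new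
  -- `□ᵢ`-formulas.
  have hdec : l (F.box i) ∈ w.1 ∨ r (F.box i) ∈ w.1 := by
    rcases Multiset.mem_add.1 hb with hb | hb
    · exact w.2.decides b (Multiset.mem_filter.1 hb).1 _ hFb
    · rw [Multiset.mem_singleton.1 hb] at hFb
      exact w.2.decides _ h _ (.box hFb)
  cases s
  · refine hdec.resolve_right fun hr => hw'.not_mem_right hF ?_
    exact hΓw' (Multiset.mem_add.2 (.inl (hmem _ F hr)))
  · refine hdec.resolve_left fun hl => hw'.not_mem_right ?_ hF
    exact hΓw' (Multiset.mem_add.2 (.inl (hmem _ F hl)))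

theorem World.truth (A : Formula V n) (w : World V n) :
    (l A ∈ w.1 → Sat World.Rel World.val A w) ∧ (r A ∈ w.1 → ¬ Sat World.Rel World.val A w) := by
  induction A generalizing w with
  | var x => exact ⟨fun h => h, fun h h' => w.2.not_mem_right h' h⟩
  | bot =>
    refine ⟨fun h => (w.2.not_provable_add (Γ := {l .bot}) (by simpa) ⟨.botL _, trivial⟩).elim,
      fun _ h => h⟩
  | and A B hA hB =>
    refine ⟨fun h => ?_, fun h => ?_⟩
    · have hp : ¬ AnalyticallyProvable _ := fun hp =>
        w.2.not_provable_add (Γ := {l (A.and B)}) (by simpa) (.andL hp)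
      refine ⟨(hA w).1 ((w.2.decides _ h A (.and_left .refl)).resolve_right fun h' => ?_),
        (hB w).1 ((w.2.decides _ h B (.and_right .refl)).resolve_right fun h' => ?_)⟩
      -- With `A` on the wrong side, the premise of the rule has `A` on both sides and is provable;
      -- the other connectives follow the same pattern.
      · exact hp (analyticallyProvable_of_mem (A := A) (by simp) (by simp [h']))
      · exact hp (analyticallyProvable_of_mem (A := B) (by simp) (by simp [h']))
    · have hAB : r A ∈ w.1 ∨ r B ∈ w.1 := by
        by_contra! hn
        have h₁ := (w.2.decides _ h A (.and_left .refl)).resolve_right hn.1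
        have h₂ := (w.2.decides _ h B (.and_right .refl)).resolve_right hn.2
        exact w.2.not_provable_add (Γ := {r (A.and B)}) (by simpa)
          (.andR (analyticallyProvable_of_mem (A := A) (by simp [h₁]) (by simp))
            (analyticallyProvable_of_mem (A := B) (by simp [h₂]) (by simp)))
      rintro ⟨sA, sB⟩
      exact hAB.elim (fun h => (hA w).2 h sA) fun h => (hB w).2 h sB
  | or A B hA hB =>
    refine ⟨fun h => ?_, fun h => ?_⟩
    · have hAB : l A ∈ w.1 ∨ l B ∈ w.1 := by
        by_contra! hn
        have h₁ := (w.2.decides _ h A (.or_left .refl)).resolve_left hn.1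
        have h₂ := (w.2.decides _ h B (.or_right .refl)).resolve_left hn.2
        exact w.2.not_provable_add (Γ := {l (A.or B)}) (by simpa)
          (.orL (analyticallyProvable_of_mem (A := A) (by simp) (by simp [h₁]))
            (analyticallyProvable_of_mem (A := B) (by simp) (by simp [h₂])))
      exact hAB.imp (hA w).1 (hB w).1
    · have hp : ¬ AnalyticallyProvable _ := fun hp =>
        w.2.not_provable_add (Γ := {r (A.or B)}) (by simpa) (.orR hp)
      rintro (s | s)
      · refine (hA w).2 ((w.2.decides _ h A (.or_left .refl)).resolve_left fun h' => ?_) s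
        exact hp (analyticallyProvable_of_mem (A := A) (by simp [h']) (by simp))
      · refine (hB w).2 ((w.2.decides _ h B (.or_right .refl)).resolve_left fun h' => ?_) s
        exact hp (analyticallyProvable_of_mem (A := B) (by simp [h']) (by simp))
  | imp A B hA hB =>
    refine ⟨fun h => ?_, fun h => ?_⟩
    · have hAB : r A ∈ w.1 ∨ l B ∈ w.1 := by
        by_contra! hn
        have h₁ := (w.2.decides _ h A (.imp_left .refl)).resolve_right hn.1
        have h₂ := (w.2.decides _ h B (.imp_right .refl)).resolve_left hn.2
        exact w.2.not_provable_add (Γ := {l (A.imp B)}) (by simpa)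
          (.impL (analyticallyProvable_of_mem (A := A) (by simp [h₁]) (by simp))
            (analyticallyProvable_of_mem (A := B) (by simp) (by simp [h₂])))
      exact fun sA => hAB.elim (fun h => ((hA w).2 h sA).elim) (hB w).1
    · have hp : ¬ AnalyticallyProvable _ := fun hp =>
        w.2.not_provable_add (Γ := {r (A.imp B)}) (by simpa) (.impR hp)
      refine fun s => (hB w).2 ?_ (s ((hA w).1 ?_))
      · refine (w.2.decides _ h B (.imp_right .refl)).resolve_left fun h' => ?_
        exact hp (analyticallyProvable_of_mem (A := B) (by simp [h']) (by simp))
      · refine (w.2.decides _ h A (.imp_left .refl)).resolve_right fun h' => ?_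
        exact hp (analyticallyProvable_of_mem (A := A) (by simp) (by simp [h']))
  | box i A hA =>
    refine ⟨fun h w' hw' => (hA w').1 ?_, fun h s => ?_⟩
    · have h' : l (A.box i) ∈ w'.1 := (hw' _ _).1 h
      refine (w'.2.decides _ h' A (.box .refl)).resolve_right fun hr => ?_
      exact w'.2.not_provable_add (Γ := {l (A.box i)}) (by simpa)
        (.boxL (analyticallyProvable_of_mem (A := A) (by simp) (by simp [hr])))
    · obtain ⟨w', hw', hr⟩ := w.exists_rel_of_box_mem h
      exact (hA w').2 hr (s w' hw')

end MultiModalS5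

theorem mainTheorem8 (V : Type*) (n : ℕ) : MultiModalS5.HasAnalyticCutProperty V n := by
  rintro Γ ⟨π⟩
  by_contra hΓ
  obtain ⟨w, hw, hΓw, -⟩ := MultiModalS5.exists_isSaturated hΓ
  -- Soundness makes some labelled formula of `Γ ⊆ w` hold at `w`, where the truth lemma refutes all
  -- of them.
  obtain ⟨⟨s, A⟩, ha, hs⟩ :=
    π.sound MultiModalS5.World.rel_equivalence MultiModalS5.World.val ⟨w, hw⟩
  have ht := MultiModalS5.World.truth A ⟨w, hw⟩
  cases s
  · exact hs (ht.1 (hΓw ha))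
  · exact ht.2 (hΓw ha) hs
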